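/- Let $p$ be a prime and let $\lambda\in\mathbb F_p$ with $\lambda\neq 0,-1$ (so $p$ is odd). Let $K_\lambda$ be the surface in the weighted projective space $\mathbb P(3,1,1,1)$ over $\mathbb F_p$, with coordinates $(v:z_0:z_1:z_2)$, defined by $$v^2=(\lambda+1)\,z_0z_1z_2(\lambda z_0+z_1)(z_1+z_2)(z_0+z_2),$$ let $E_\lambda$ be the elliptic curve $y^2=x^3-2x^2+\frac{\lambda}{\lambda+1}x$ over $\mathbb F_p$, and put $a_{\lambda,p}=p+1-\#E_\lambda(\mathbb F_p)$. Then $$\#K_\lambda(\mathbb F_p)=p^2+1+a_{\lambda,p}^2 .$$ -/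

import Mathlib

/-- Two nonzero vectors with coordinates in `F` give the same point of the weighted projective
space with weights `w` if they are in the same orbit of the action
`c • x = (c ^ w i * x i)` of the multiplicative group of an algebraic closure of `F`. -/
def weightedProjSetoid (F : Type*) [Field F] {ι : Type*} (w : ι → ℕ) :
    Setoid {x : ι → F // x ≠ 0} where
  r x y := ∃ c : (AlgebraicClosure F)ˣ, ∀ i,
    algebraMap F (AlgebraicClosure F) (y.1 i) =
      (c : AlgebraicClosure F) ^ w i * algebraMap F (AlgebraicClosure F) (x.1 i)
  iseqv :=
    { refl := fun _ => ⟨1, fun _ => by simp⟩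
      symm := by
        rintro x y ⟨c, hc⟩
        refine ⟨c⁻¹, fun i => ?_⟩
        rw [hc i, ← mul_assoc, ← mul_pow, Units.inv_mul, one_pow, one_mul]
      trans := by
        rintro x y z ⟨c, hc⟩ ⟨d, hd⟩
        refine ⟨d * c, fun i => ?_⟩
        rw [hd i, hc i, Units.val_mul, mul_pow, mul_assoc] }

/-- The `F`-rational points of the weighted projective space with weights `w`. Every geometric
point that is rational over `F` has a representative with coordinates in `F` (Hilbert 90), so
these are the nonzero vectors over `F` up to geometric equivalence. -/
def WeightedProjSpace (F : Type*) [Field F] {ι : Type*} (w : ι → ℕ) : Type _ :=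
  Quotient (weightedProjSetoid F w)

/-- The rational points of the hypersurface `f = 0` in weighted projective space, for a
weighted homogeneous polynomial `f`. -/
def weightedZeroLocus {F : Type*} [Field F] {ι : Type*} (w : ι → ℕ) (f : MvPolynomial ι F) :
    Set (WeightedProjSpace F w) :=
  {P | ∃ x : {x : ι → F // x ≠ 0},
    Quotient.mk (weightedProjSetoid F w) x = P ∧ MvPolynomial.eval x.1 f = 0}

/-- The weights of `ℙ(3,1,1,1)`. -/
def doublePlaneWeights : Fin 4 → ℕ := ![3, 1, 1, 1]

open MvPolynomial in
/-- The sextic `v² - (l+1) z₀ z₁ z₂ (l z₀ + z₁) (z₁ + z₂) (z₀ + z₂)` in the variables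
`(v, z₀, z₁, z₂) = (X 0, X 1, X 2, X 3)`. -/
noncomputable def doublePlanePoly {F : Type*} [Field F] (l : F) : MvPolynomial (Fin 4) F :=
  X 0 ^ 2 - C (l + 1) * X 1 * X 2 * X 3 * (C l * X 1 + X 2) * (X 2 + X 3) * (X 1 + X 3)

open MvPolynomial in
/-- The equation of the double plane is weighted homogeneous of degree `6`. -/
theorem doublePlanePoly_isWeightedHomogeneous {F : Type*} [Field F] (l : F) :
    IsWeightedHomogeneous doublePlaneWeights (doublePlanePoly l) 6 := by
  have h0 : IsWeightedHomogeneous doublePlaneWeights (X 0 : MvPolynomial (Fin 4) F) 3 :=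
    isWeightedHomogeneous_X F doublePlaneWeights 0
  have h1 : IsWeightedHomogeneous doublePlaneWeights (X 1 : MvPolynomial (Fin 4) F) 1 :=
    isWeightedHomogeneous_X F doublePlaneWeights 1
  have h2 : IsWeightedHomogeneous doublePlaneWeights (X 2 : MvPolynomial (Fin 4) F) 1 :=
    isWeightedHomogeneous_X F doublePlaneWeights 2
  have h3 : IsWeightedHomogeneous doublePlaneWeights (X 3 : MvPolynomial (Fin 4) F) 1 :=
    isWeightedHomogeneous_X F doublePlaneWeights 3
  have hc : ∀ a : F, IsWeightedHomogeneous doublePlaneWeights (C a : MvPolynomial (Fin 4) F) 0 :=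
    fun a => isWeightedHomogeneous_C _ a
  have hl : IsWeightedHomogeneous doublePlaneWeights
      (C l * X 1 + X 2 : MvPolynomial (Fin 4) F) 1 := by
    simpa using ((hc l).mul h1).add (by simpa using h2)
  have hA := h0.pow 2
  have hB := ((((((hc (l + 1)).mul h1).mul h2).mul h3).mul hl).mul (h2.add h3)).mul (h1.add h3)
  exact (weightedHomogeneousSubmodule F doublePlaneWeights 6).sub_mem hA hB

/-- The set of `F`-rational points of the double plane
`K_l : v² = (l+1) z₀ z₁ z₂ (l z₀ + z₁) (z₁ + z₂) (z₀ + z₂)` in `ℙ(3,1,1,1)`. -/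
noncomputable def doublePlane {F : Type*} [Field F] (l : F) :
    Set (WeightedProjSpace F doublePlaneWeights) :=
  weightedZeroLocus doublePlaneWeights (doublePlanePoly l)

/-- The Weierstrass curve `E_l : y² = x³ - 2 x² + (l / (l+1)) x`. -/
def legendreTypeCurve {F : Type*} [Field F] (l : F) : WeierstrassCurve F where
  a₁ := 0
  a₂ := -2
  a₃ := 0
  a₄ := l / (l + 1)
  a₆ := 0

/-- For `l ≠ 0, -1` in characteristic different from `2`, the curve `E_l` is elliptic. -/
theorem legendreTypeCurve_isElliptic {F : Type*} [Field F] (l : F) (h2 : (2 : F) ≠ 0)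
    (h0 : l ≠ 0) (h1 : l ≠ -1) : (legendreTypeCurve l).IsElliptic := by
  have h1' : l + 1 ≠ 0 := fun h => h1 (eq_neg_of_add_eq_zero_left h)
  refine ⟨isUnit_iff_ne_zero.mpr ?_⟩
  have : (legendreTypeCurve l).Δ = 2 ^ 6 * l ^ 2 / (l + 1) ^ 3 := by
    simp only [legendreTypeCurve, WeierstrassCurve.Δ, WeierstrassCurve.b₂, WeierstrassCurve.b₄,
      WeierstrassCurve.b₆, WeierstrassCurve.b₈]
    field_simp
    ring
  rw [this]
  positivity

/-- The Frobenius trace `a_{l,p} = p + 1 - #E_l(𝔽_p)`; the points of `E_l` are the affine ones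
and the point at infinity. -/
noncomputable def frobTrace (p : ℕ) [Fact p.Prime] (l : ZMod p) : ℤ :=
  (p : ℤ) + 1 - (Nat.card (legendreTypeCurve l).toAffine.Point : ℤ)

/-! ### Quadratic character sums and the square of the elliptic sum. -/

section CharacterSums

/-! Write χ for the quadratic character, q for the order of the field, c = 1/(l+1) and e = l/(l+1),
so that c + e = 1. Counting points on both sides, and shifting or rescaling coordinates, reduces the
theorem to S² = q + ∑ χ(k(k+c)y(y+e)(y+k)), the sum over all k, y, where S = ∑ χ((x+1)(x²-c)) is
minus the Frobenius trace. This is `sq_sum_quadraticChar`.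

In S² the summand depends only on t = x+y and u = xy, and a pair (t, u) arises χ(t²-4u) + 1 times.
With r = u+t+1 in place of u, the "+1" part is a sum over quadratics in t and contributes q. The
other part is a sum of χ(QA) for two quadratics Q, A in t. Sorting t by the value k = Q/A turns it
into a sum over the discriminants of the pencil Q - kA (`sum_quadraticChar_pencil`), and the
remaining sum over r becomes the sum over y by `sum_quadraticChar_reciprocal`. -/

theorem sum_comp_eq_sum_card {α β : Type*} [Fintype α] [Fintype β] [DecidableEq β] (g : α → β)
    (f : β → ℤ) :
    ∑ x, f (g x) = ∑ w, ((Finset.univ.filter fun x => g x = w).card : ℤ) * f w := by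
  simp_rw [Finset.card_filter, Nat.cast_sum, Finset.sum_mul]
  rw [Finset.sum_comm]
  simp

variable {F : Type*} [Field F] [Fintype F] [DecidableEq F]

theorem card_roots_quadratic (hF : ringChar F ≠ 2) {a : F} (ha : a ≠ 0) (b c : F) :
    ((Finset.univ.filter fun x : F => a * x ^ 2 + b * x + c = 0).card : ℤ) =
      quadraticChar F (b ^ 2 - 4 * a * c) + 1 := by
  have h2 : (2 : F) ≠ 0 := Ring.two_ne_zero hF
  have h4 : (4 : F) ≠ 0 := by
    have : (4 : F) = 2 * 2 := by norm_num
    rw [this]; exact mul_ne_zero h2 h2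
  rw [← quadraticChar_card_sqrts hF]
  norm_cast
  refine Finset.card_nbij' (fun x => 2 * a * x + b) (fun y => (y - b) / (2 * a)) ?_ ?_ ?_ ?_
  · intro x hx
    simp only [Finset.coe_filter, Finset.mem_univ, true_and, Set.mem_ofPred_eq,
      Set.coe_toFinset] at hx ⊢
    linear_combination 4 * a * hx
  · intro y hy
    simp only [Finset.coe_filter, Finset.mem_univ, true_and, Set.mem_ofPred_eq,
      Set.coe_toFinset] at hy ⊢
    field_simp
    linear_combination hy
  · intro x _
    field_simp
    ring
  · intro y _
    field_simp
    ring

/-- The number of roots of a possibly degenerate quadratic polynomial that is not zero. -/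
theorem card_roots_of_ne_zero (hF : ringChar F ≠ 2) (a b c : F) (h : a = 0 → b = 0 → c ≠ 0) :
    ((Finset.univ.filter fun x : F => a * x ^ 2 + b * x + c = 0).card : ℤ) =
      quadraticChar F (b ^ 2 - 4 * a * c) + 1 - if a = 0 then 1 else 0 := by
  by_cases ha : a = 0
  · subst ha
    by_cases hb : b = 0
    · subst hb
      simp [h rfl rfl]
    · have : (Finset.univ.filter fun x : F => 0 * x ^ 2 + b * x + c = 0) = {-c / b} := by
        ext x
        simp only [Finset.mem_filter, Finset.mem_univ, true_and, Finset.mem_singleton]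
        rw [eq_div_iff hb]
        constructor <;> intro h' <;> linear_combination h'
      rw [this]
      simp [quadraticChar_sq_one' hb]
  · simp [card_roots_quadratic hF ha, ha]

/-- Double count the pairs (t, r) with r² - tr + D = 0: each r ≠ 0 determines t, while r = 0 allows
every t or none. -/
theorem sum_quadraticChar_sq_sub (hF : ringChar F ≠ 2) (D : F) :
    ∑ t : F, quadraticChar F (t ^ 2 - 4 * D) =
      -1 + if D = 0 then (Fintype.card F : ℤ) else 0 := by
  have key : ∑ t : F, (quadraticChar F (t ^ 2 - 4 * D) + 1) =
      ∑ r : F, ((Finset.univ.filter fun t : F => r ^ 2 - t * r + D = 0).card : ℤ) := by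
    have : ∀ t : F, quadraticChar F (t ^ 2 - 4 * D) + 1 =
        ((Finset.univ.filter fun r : F => r ^ 2 - t * r + D = 0).card : ℤ) := by
      intro t
      have := card_roots_quadratic hF one_ne_zero (-t) D
      simp only [one_mul, neg_mul, neg_sq, ← sub_eq_add_neg, mul_one] at this
      exact this.symm
    simp_rw [this, Finset.card_filter, Nat.cast_sum]
    exact Finset.sum_comm
  have hr : ∀ r : F, ((Finset.univ.filter fun t : F => r ^ 2 - t * r + D = 0).card : ℤ) =
      1 + if r = 0 then -1 + (if D = 0 then (Fintype.card F : ℤ) else 0) else 0 := by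
    intro r
    by_cases h : r = 0
    · subst h
      by_cases hD : D = 0 <;> simp [hD]
    · have : (Finset.univ.filter fun t : F => r ^ 2 - t * r + D = 0) = {(r ^ 2 + D) / r} := by
        ext x
        simp only [Finset.mem_filter, Finset.mem_univ, true_and, Finset.mem_singleton]
        rw [eq_div_iff h]
        constructor <;> intro h' <;> linear_combination -h'
      rw [this]
      simp [h]
  simp_rw [hr, Finset.sum_add_distrib] at key
  simp only [Finset.sum_const, Finset.sum_ite_eq', Finset.mem_univ, if_true] at key
  linarith

theorem sum_quadraticChar_quadratic (hF : ringChar F ≠ 2) {a : F} (ha : a ≠ 0) (b c : F) :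
    ∑ t : F, quadraticChar F (a * t ^ 2 + 2 * b * t + c) =
      quadraticChar F a * (-1 + if b ^ 2 - a * c = 0 then (Fintype.card F : ℤ) else 0) := by
  have h2 : (2 : F) ≠ 0 := Ring.two_ne_zero hF
  have h4 : (4 : F) ≠ 0 := by
    have : (4 : F) = 2 * 2 := by norm_num
    rw [this]; exact mul_ne_zero h2 h2
  have hD : (b ^ 2 - a * c = 0) ↔ ((b ^ 2 - a * c) / 4 = 0) := by simp [h4]
  simp_rw [hD]
  rw [← sum_quadraticChar_sq_sub hF, Finset.mul_sum]
  refine Fintype.sum_equiv ((Equiv.mulLeft₀ a ha).trans (Equiv.addRight b)) _ _ fun t => ?_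
  have : (a * t + b) ^ 2 - 4 * ((b ^ 2 - a * c) / 4) = a * (a * t ^ 2 + 2 * b * t + c) := by
    field_simp
    ring
  change _ = _ * quadraticChar F ((a * t + b) ^ 2 - 4 * ((b ^ 2 - a * c) / 4))
  rw [this, map_mul, ← mul_assoc, ← sq, quadraticChar_sq_one ha, one_mul]

theorem quadraticChar_sq_mul {a : F} (ha : a ≠ 0) (b : F) :
    quadraticChar F (a ^ 2 * b) = quadraticChar F b := by
  rw [map_mul, quadraticChar_sq_one' ha, one_mul]

/-- The square of a character sum, by the elementary symmetric functions of a pair. -/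
theorem sum_prod_eq_sum_symm (hF : ringChar F ≠ 2) (G : F → F → ℤ) :
    ∑ x : F, ∑ y : F, G (x + y) (x * y) =
      ∑ t : F, ∑ u : F, (quadraticChar F (t ^ 2 - 4 * u) + 1) * G t u := by
  have h1 : ∑ x : F, ∑ y : F, G (x + y) (x * y) = ∑ t : F, ∑ x : F, G t (x * (t - x)) := by
    conv_rhs => rw [Finset.sum_comm]
    refine Finset.sum_congr rfl fun x _ => ?_
    refine Fintype.sum_equiv (Equiv.addLeft x) _ _ fun y => ?_
    simp
  rw [h1]
  refine Finset.sum_congr rfl fun t _ => ?_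
  rw [sum_comp_eq_sum_card (fun x => x * (t - x)) (G t)]
  refine Finset.sum_congr rfl fun u _ => ?_
  congr 1
  have := card_roots_quadratic hF one_ne_zero (-t) u
  rw [neg_sq, mul_one] at this
  rw [← this]
  congr 2
  ext x
  simp only [Finset.mem_filter, Finset.mem_univ, true_and]
  constructor <;> intro h' <;> linear_combination -h'

/-- For r ≠ 0 the argument is r²(w + 4k - 2e) with w = r + e²/r, which is invariant under r ↦ e²/r
up to squares. A value w is taken χ(w² - 4e²) + 1 times. -/
theorem sum_quadraticChar_reciprocal (hF : ringChar F ≠ 2) {e : F} (he : e ≠ 0) (k : F) :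
    ∑ r : F, quadraticChar F (r * ((r - e) ^ 2 + 4 * r * k)) =
      ∑ y : F, quadraticChar F (y * (y + e) * (y + k)) := by
  have h2 : (2 : F) ≠ 0 := Ring.two_ne_zero hF
  have h4 : (4 : F) ≠ 0 := by
    have : (4 : F) = 2 * 2 := by norm_num
    rw [this]; exact mul_ne_zero h2 h2
  have step : ∀ r : F, quadraticChar F (r * ((r - e) ^ 2 + 4 * r * k)) =
      ∑ w : F, if r ^ 2 + (-w) * r + e ^ 2 = 0 then quadraticChar F (w + 4 * k - 2 * e) else 0 := by
    intro r
    by_cases hr : r = 0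
    · subst hr
      simp [he]
    · have : ∀ w, (r ^ 2 + (-w) * r + e ^ 2 = 0) ↔ w = (r ^ 2 + e ^ 2) / r := by
        intro w
        rw [eq_div_iff hr]
        constructor <;> intro h' <;> linear_combination -h'
      simp_rw [this]
      rw [Finset.sum_ite_eq' _ _ _, if_pos (Finset.mem_univ _), ← quadraticChar_sq_mul hr (_ + _ - _)]
      congr 1
      field_simp
      ring
  simp_rw [step]
  rw [Finset.sum_comm]
  have inner : ∀ w : F, (∑ r : F, if r ^ 2 + (-w) * r + e ^ 2 = 0 then
      quadraticChar F (w + 4 * k - 2 * e) else 0) =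
      quadraticChar F ((w ^ 2 - 4 * e ^ 2) * (w + 4 * k - 2 * e)) +
        quadraticChar F (w + 4 * k - 2 * e) := by
    intro w
    have := card_roots_quadratic hF one_ne_zero (-w) (e ^ 2)
    simp only [one_mul, neg_sq, mul_one] at this
    rw [← Finset.sum_filter, Finset.sum_const, nsmul_eq_mul, this, map_mul]
    ring
  simp_rw [inner, Finset.sum_add_distrib]
  have hz : ∑ w : F, quadraticChar F (w + 4 * k - 2 * e) = 0 := by
    rw [← quadraticChar_sum_zero hF]
    refine Fintype.sum_equiv (Equiv.addRight (4 * k - 2 * e)) _ _ fun w => ?_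
    simp [add_sub_assoc]
  rw [hz, add_zero]
  symm
  -- The substitution w = 4y + 2e factors w² - 4e² as 16y(y+e); the total constant is 64 = 8².
  refine Fintype.sum_equiv ((Equiv.mulLeft₀ 4 h4).trans (Equiv.addRight (2 * e))) _ _ fun y => ?_
  change _ = quadraticChar F (((4 * y + 2 * e) ^ 2 - 4 * e ^ 2) * (4 * y + 2 * e + 4 * k - 2 * e))
  have h8 : (8 : F) ≠ 0 := by
    have : (8 : F) = 2 * 4 := by norm_num
    rw [this]; exact mul_ne_zero h2 h4
  rw [← quadraticChar_sq_mul h8 (y * _ * _)]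
  congr 1
  ring

/-- χ(QA) = χ(Q/A), so t is sorted by the parameter k of the member Q - kA that vanishes at t. The
discriminant of that member is 4(k+c)((r-e)² + 4rk). At k = e the leading coefficient drops out,
which costs χ(e). -/
theorem sum_quadraticChar_pencil (hF : ringChar F ≠ 2) {c e : F} (he : e ≠ 0) (hce : c + e = 1)
    (r : F) :
    ∑ t : F, quadraticChar F ((e * t ^ 2 - 2 * (r - e) * t + (r - e) ^ 2) *
        ((t + 2) ^ 2 - 4 * r)) =
      (∑ k : F, quadraticChar F (k * (k + c) * ((r - e) ^ 2 + 4 * r * k))) -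
        quadraticChar F e := by
  have h2 : (2 : F) ≠ 0 := Ring.two_ne_zero hF
  have h4 : (4 : F) ≠ 0 := by
    have : (4 : F) = 2 * 2 := by norm_num
    rw [this]; exact mul_ne_zero h2 h2
  have hc : c = 1 - e := by linear_combination hce
  -- At a common zero of Q and A every k is counted, and the sum of χ over all k vanishes, as it
  -- should.
  have step : ∀ Q A : F, quadraticChar F (Q * A) =
      ∑ k : F, if Q = k * A then quadraticChar F k else 0 := by
    intro Q A
    by_cases hA : A = 0
    · subst hA
      by_cases hQ : Q = 0
      · simp only [hQ, mul_zero, if_true, quadraticChar_sum_zero hF, quadraticChar_zero]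
      · simp [hQ]
    · have : ∀ k, (Q = k * A) ↔ k = Q / A := by
        intro k
        rw [eq_div_iff hA, eq_comm]
      simp_rw [this]
      rw [Finset.sum_ite_eq' _ _ _, if_pos (Finset.mem_univ _), ← quadraticChar_sq_mul hA (Q / A)]
      congr 1
      field_simp
  rw [Finset.sum_congr rfl fun t _ => step _ _, Finset.sum_comm]
  have inner : ∀ k : F, (∑ t : F, if e * t ^ 2 - 2 * (r - e) * t + (r - e) ^ 2 =
      k * ((t + 2) ^ 2 - 4 * r) then quadraticChar F k else 0) =
      quadraticChar F (k * (k + c) * ((r - e) ^ 2 + 4 * r * k)) + quadraticChar F k -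
        if k = e then quadraticChar F k else 0 := by
    intro k
    -- No member of the pencil is identically zero: k = e and r = -e leave the constant term -4e.
    have := card_roots_of_ne_zero hF (e - k) (-2 * (r - e) - 4 * k) ((r - e) ^ 2 - 4 * k * (1 - r))
      (by
        intro h0 h1 h3
        have hk : k = e := by linear_combination -h0
        subst hk
        have hr : r = -k := by
          have : 2 * (r + k) = 0 := by linear_combination -h1
          have := (mul_eq_zero.mp this).resolve_left h2
          linear_combination this
        subst hr
        apply mul_ne_zero h4 he
        linear_combination -h3)
    have hfil : (Finset.univ.filter fun t : F => e * t ^ 2 - 2 * (r - e) * t + (r - e) ^ 2 =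
      k * ((t + 2) ^ 2 - 4 * r)) = Finset.univ.filter fun t : F =>
        (e - k) * t ^ 2 + (-2 * (r - e) - 4 * k) * t + ((r - e) ^ 2 - 4 * k * (1 - r)) = 0 := by
      ext t
      simp only [Finset.mem_filter, Finset.mem_univ, true_and]
      constructor <;> intro h' <;> linear_combination h'
    have hdisc : (-2 * (r - e) - 4 * k) ^ 2 - 4 * (e - k) * ((r - e) ^ 2 - 4 * k * (1 - r)) =
        2 ^ 2 * ((k + c) * ((r - e) ^ 2 + 4 * r * k)) := by
      rw [hc]; ring
    have hek : (e - k = 0) ↔ k = e := by rw [sub_eq_zero, eq_comm]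
    rw [← Finset.sum_filter, Finset.sum_const, nsmul_eq_mul, hfil, this, hdisc,
      quadraticChar_sq_mul h2, mul_assoc k, map_mul _ k]
    simp_rw [hek]
    split_ifs <;> ring
  simp_rw [inner, Finset.sum_sub_distrib, Finset.sum_add_distrib, quadraticChar_sum_zero hF,
    add_zero]
  simp

/-- A finite-field analogue of Clausen's formula. -/
theorem sq_sum_quadraticChar (hF : ringChar F ≠ 2) {c e : F} (hc : c ≠ 0) (he : e ≠ 0)
    (hce : c + e = 1) :
    (∑ x : F, quadraticChar F ((x + 1) * (x ^ 2 - c))) ^ 2 =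
      Fintype.card F +
        ∑ k : F, ∑ y : F, quadraticChar F (k * (k + c) * (y * (y + e) * (y + k))) := by
  have h1 : (∑ x : F, quadraticChar F ((x + 1) * (x ^ 2 - c))) ^ 2 =
      ∑ t : F, ∑ u : F, (quadraticChar F (t ^ 2 - 4 * u) + 1) *
        quadraticChar F ((u + t + 1) * ((u + c) ^ 2 - c * t ^ 2)) := by
    rw [← sum_prod_eq_sum_symm hF
      (fun t u => quadraticChar F ((u + t + 1) * ((u + c) ^ 2 - c * t ^ 2))), sq,
      Finset.sum_mul_sum]
    refine Finset.sum_congr rfl fun x _ => Finset.sum_congr rfl fun y _ => ?_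
    rw [← map_mul]
    congr 1
    ring
  have h2 : ∀ t : F, ∑ u : F, (quadraticChar F (t ^ 2 - 4 * u) + 1) *
        quadraticChar F ((u + t + 1) * ((u + c) ^ 2 - c * t ^ 2)) =
      ∑ r : F, (quadraticChar F r * quadraticChar F
          ((e * t ^ 2 - 2 * (r - e) * t + (r - e) ^ 2) * ((t + 2) ^ 2 - 4 * r)) +
        quadraticChar F r * quadraticChar F (e * t ^ 2 + 2 * (-(r - e)) * t + (r - e) ^ 2)) := by
    intro t
    -- The new variable is r = u + t + 1, the factor (x+1)(y+1).
    refine Fintype.sum_equiv (Equiv.addRight (t + 1)) _ _ fun u => ?_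
    simp only [Equiv.coe_addRight]
    rw [add_mul, ← map_mul, ← map_mul, ← map_mul, one_mul]
    have hc' : c = 1 - e := by linear_combination hce
    congr 2 <;> rw [hc'] <;> ring
  rw [h1]
  simp_rw [h2]
  rw [Finset.sum_comm]
  simp_rw [Finset.sum_add_distrib, ← Finset.mul_sum, sum_quadraticChar_pencil hF he hce,
    sum_quadraticChar_quadratic hF he]
  have hdisc : ∀ r : F, ((-(r - e)) ^ 2 - e * (r - e) ^ 2 = 0) ↔ r = e := by
    intro r
    have : (-(r - e)) ^ 2 - e * (r - e) ^ 2 = c * (r - e) ^ 2 := by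
      linear_combination -(r - e) ^ 2 * hce
    rw [this]
    simp [hc, sub_eq_zero]
  simp_rw [hdisc, @mul_sub ℤ, @mul_add ℤ, Finset.sum_sub_distrib, Finset.sum_add_distrib]
  -- Both terms ±χ(e) independent of r die against the sum of χ(r); only the degenerate quadratic at
  -- r = e survives, giving q.
  rw [← Finset.sum_mul, ← Finset.sum_mul, quadraticChar_sum_zero hF]
  have hlast : ∑ r : F, quadraticChar F r * (quadraticChar F e *
      if r = e then (Fintype.card F : ℤ) else 0) = Fintype.card F := by
    simp only [mul_ite, mul_zero, Finset.sum_ite_eq', Finset.mem_univ, if_true]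
    rw [← mul_assoc, ← sq, quadraticChar_sq_one he, one_mul]
  rw [hlast]
  simp_rw [Finset.mul_sum]
  rw [Finset.sum_comm]
  have hk : ∀ k : F, (∑ r : F, quadraticChar F r *
      quadraticChar F (k * (k + c) * ((r - e) ^ 2 + 4 * r * k))) =
      ∑ y : F, quadraticChar F (k * (k + c) * (y * (y + e) * (y + k))) := by
    intro k
    simp_rw [map_mul _ (k * (k + c)), ← Finset.mul_sum, ← sum_quadraticChar_reciprocal hF he k,
      Finset.mul_sum, map_mul]
    refine Finset.sum_congr rfl fun r _ => ?_
    ring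
  simp_rw [hk]
  ring

end CharacterSums

/-! ### Point counts as character sums. -/

section PointCounts

variable {F : Type*} [Field F] [Fintype F] [DecidableEq F]

theorem card_sq_eq (hF : ringChar F ≠ 2) {α : Type*} [Fintype α] (g : α → F) :
    (Nat.card {q : α × F // q.2 ^ 2 = g q.1} : ℤ) = ∑ x, (quadraticChar F (g x) + 1) := by
  have e : {q : α × F // q.2 ^ 2 = g q.1} ≃ (x : α) × {v : F // v ^ 2 = g x} :=
    { toFun := fun q => ⟨q.1.1, q.1.2, q.2⟩
      invFun := fun s => ⟨(s.1, s.2.1), s.2.2⟩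
      left_inv := fun _ => rfl
      right_inv := fun _ => rfl }
  rw [Nat.card_congr e, Nat.card_sigma, Nat.cast_sum]
  refine Finset.sum_congr rfl fun x _ => ?_
  rw [← quadraticChar_card_sqrts hF, Nat.card_eq_fintype_card, Fintype.card_subtype]
  congr 2
  ext v
  simp

theorem card_point_legendreTypeCurve (hF : ringChar F ≠ 2) {l : F} (h0 : l ≠ 0) (h1 : l ≠ -1) :
    (Nat.card (legendreTypeCurve l).toAffine.Point : ℤ) =
      Fintype.card F + 1 + ∑ x : F, quadraticChar F ((x + 1) * (x ^ 2 - 1 / (l + 1))) := by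
  have hl : l + 1 ≠ 0 := fun h => h1 (eq_neg_of_add_eq_zero_left h)
  have := legendreTypeCurve_isElliptic l (Ring.two_ne_zero hF) h0 h1
  have e : {xy : F × F // (legendreTypeCurve l).toAffine.Equation xy.1 xy.2} ≃
      {q : F × F // q.2 ^ 2 = q.1 * (q.1 ^ 2 - 2 * q.1 + l / (l + 1))} := by
    refine Equiv.subtypeEquivRight fun q => ?_
    rw [WeierstrassCurve.Affine.equation_iff]
    simp only [legendreTypeCurve]
    constructor <;> intro h <;> linear_combination h
  rw [Nat.card_congr (WeierstrassCurve.Affine.pointEquiv (legendreTypeCurve l).toAffine)]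
  change (Nat.card (Option _) : ℤ) = _
  rw [Finite.card_option, Nat.card_congr e, Nat.cast_add,
    card_sq_eq hF (fun x => x * (x ^ 2 - 2 * x + l / (l + 1))), Finset.sum_add_distrib]
  have : ∑ x : F, quadraticChar F (x * (x ^ 2 - 2 * x + l / (l + 1))) =
      ∑ x : F, quadraticChar F ((x + 1) * (x ^ 2 - 1 / (l + 1))) := by
    -- Replacing x by x + 1 turns x² - 2x + l/(l+1) into x² - 1/(l+1).
    symm
    refine Fintype.sum_equiv (Equiv.addRight 1) _ _ fun x => ?_
    simp only [Equiv.coe_addRight]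
    congr 1
    field_simp
    ring
  rw [this]
  simp
  ring

theorem eval_doublePlanePoly {F : Type*} [Field F] (l : F) (x : Fin 4 → F) :
    MvPolynomial.eval x (doublePlanePoly l) =
      x 0 ^ 2 - (l + 1) * x 1 * x 2 * x 3 * (l * x 1 + x 2) * (x 2 + x 3) * (x 1 + x 3) := by
  simp [doublePlanePoly]

/-- Vectors with nonzero projection to the last three coordinates are equivalent over the
algebraic closure only if they are so over the base field. -/
theorem weightedProjSetoid_iff {F : Type*} [Field F] (x y : {x : Fin 4 → F // x ≠ 0})
    (i : Fin 4) (hi : doublePlaneWeights i = 1) (hx : x.1 i ≠ 0) :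
    weightedProjSetoid F doublePlaneWeights x y ↔
      ∃ c : F, c ≠ 0 ∧ ∀ j, y.1 j = c ^ doublePlaneWeights j * x.1 j := by
  constructor
  · rintro ⟨c, hc⟩
    have hinj := (algebraMap F (AlgebraicClosure F)).injective
    have hx' : algebraMap F (AlgebraicClosure F) (x.1 i) ≠ 0 := by simpa using hx
    have h1 : (c : AlgebraicClosure F) = algebraMap F (AlgebraicClosure F) (y.1 i / x.1 i) := by
      have := hc i
      rw [hi, pow_one] at this
      rw [map_div₀, this, mul_div_assoc, div_self hx', mul_one]
    refine ⟨y.1 i / x.1 i, ?_, fun j => hinj ?_⟩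
    · intro h
      rw [h, map_zero] at h1
      exact c.ne_zero h1
    · rw [hc j, h1, map_mul, map_pow]
  · rintro ⟨c, hc0, hc⟩
    refine ⟨Units.map (algebraMap F (AlgebraicClosure F)).toMonoidHom (Units.mk0 c hc0),
      fun j => ?_⟩
    rw [hc j]
    simp

/-- The affine cell and the points at infinity of the double plane. -/
def doublePlaneRep {F : Type*} [Field F] (l : F) :
    {q : (F × F) × F // q.2 ^ 2 =
        (l + 1) * q.1.1 * q.1.2 * (l + q.1.1) * (q.1.1 + q.1.2) * (1 + q.1.2)} ⊕ Option F →
      {x : Fin 4 → F // x ≠ 0}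
  | .inl q => ⟨![q.1.2, 1, q.1.1.1, q.1.1.2], fun h => one_ne_zero (congrFun h 1)⟩
  | .inr (some b) => ⟨![0, 0, 1, b], fun h => one_ne_zero (congrFun h 2)⟩
  | .inr none => ⟨![0, 0, 0, 1], fun h => one_ne_zero (congrFun h 3)⟩

theorem eval_doublePlaneRep {F : Type*} [Field F] (l : F) (s) :
    MvPolynomial.eval (doublePlaneRep l s).1 (doublePlanePoly l) = 0 := by
  rw [eval_doublePlanePoly]
  rcases s with ⟨q, hq⟩ | _ | b
  · simp only [doublePlaneRep, Matrix.cons_val]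
    linear_combination hq
  · simp [doublePlaneRep]
  · simp [doublePlaneRep]

theorem doublePlaneRep_injective {F : Type*} [Field F] (l : F) (s t)
    (h : weightedProjSetoid F doublePlaneWeights (doublePlaneRep l s) (doublePlaneRep l t)) :
    s = t := by
  rcases s with ⟨⟨⟨a, b⟩, v⟩, hq⟩ | _ | b
  · rw [weightedProjSetoid_iff _ _ 1 rfl (by simp [doublePlaneRep])] at h
    obtain ⟨c, hc0, hc⟩ := h
    rcases t with ⟨⟨⟨a', b'⟩, v'⟩, hq'⟩ | _ | b'
    · simp [doublePlaneRep, Fin.forall_fin_succ, doublePlaneWeights] at hc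
      obtain ⟨h0, h1, h2, h3⟩ := hc
      subst h1
      simp_all
    · simpa [doublePlaneRep, doublePlaneWeights, hc0, hc0.symm] using hc 1
    · simpa [doublePlaneRep, doublePlaneWeights, hc0, hc0.symm] using hc 1
  · rw [weightedProjSetoid_iff _ _ 3 rfl (by simp [doublePlaneRep])] at h
    obtain ⟨c, hc0, hc⟩ := h
    rcases t with ⟨⟨⟨a', b'⟩, v'⟩, hq'⟩ | _ | b'
    · simpa [doublePlaneRep, doublePlaneWeights, hc0, hc0.symm] using hc 1
    · rfl
    · simpa [doublePlaneRep, doublePlaneWeights, hc0, hc0.symm] using hc 2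
  · rw [weightedProjSetoid_iff _ _ 2 rfl (by simp [doublePlaneRep])] at h
    obtain ⟨c, hc0, hc⟩ := h
    rcases t with ⟨⟨⟨a', b'⟩, v'⟩, hq'⟩ | _ | b'
    · simpa [doublePlaneRep, doublePlaneWeights, hc0, hc0.symm] using hc 1
    · simpa [doublePlaneRep, doublePlaneWeights, hc0, hc0.symm] using hc 2
    · simp [doublePlaneRep, Fin.forall_fin_succ, doublePlaneWeights] at hc
      obtain ⟨h2, h3⟩ := hc
      subst h2
      simp_all

theorem exists_doublePlaneRep {F : Type*} [Field F] (l : F) (x : {x : Fin 4 → F // x ≠ 0})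
    (hx : MvPolynomial.eval x.1 (doublePlanePoly l) = 0) :
    ∃ s, weightedProjSetoid F doublePlaneWeights (doublePlaneRep l s) x := by
  rw [eval_doublePlanePoly] at hx
  by_cases h1 : x.1 1 = 0
  -- On the line z₀ = 0 the sextic vanishes, so v = 0; in particular (1:0:0:0) is not on the
  -- surface.
  · have h0 : x.1 0 = 0 := by simpa [h1] using hx
    by_cases h2 : x.1 2 = 0
    · have h3 : x.1 3 ≠ 0 := by
        intro h3
        refine x.2 (funext fun i => ?_)
        fin_cases i <;> simpa
      refine ⟨.inr none, ?_⟩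
      rw [weightedProjSetoid_iff _ _ 3 rfl (by simp [doublePlaneRep])]
      exact ⟨x.1 3, h3, by
        simp [Fin.forall_fin_succ, doublePlaneRep, doublePlaneWeights, h0, h1, h2]⟩
    · refine ⟨.inr (some (x.1 3 / x.1 2)), ?_⟩
      rw [weightedProjSetoid_iff _ _ 2 rfl (by simp [doublePlaneRep])]
      exact ⟨x.1 2, h2, by
        simp [Fin.forall_fin_succ, doublePlaneRep, doublePlaneWeights, h0, h1]
        field_simp⟩
  · refine ⟨.inl ⟨((x.1 2 / x.1 1, x.1 3 / x.1 1), x.1 0 / x.1 1 ^ 3), ?_⟩, ?_⟩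
    · field_simp
      linear_combination hx
    · rw [weightedProjSetoid_iff _ _ 1 rfl (by simp [doublePlaneRep])]
      exact ⟨x.1 1, h1, by
        simp [Fin.forall_fin_succ, doublePlaneRep, doublePlaneWeights]
        field_simp
        simp⟩

/-- The cell z₀ = 1 contributes q² plus the character sum; the line z₀ = 0 lies in the branch locus
and contributes q + 1. -/
theorem card_doublePlane (hF : ringChar F ≠ 2) (l : F) :
    (Nat.card (doublePlane l) : ℤ) = (Fintype.card F : ℤ) ^ 2 + Fintype.card F + 1 +
      ∑ x : F, ∑ y : F, quadraticChar F ((l + 1) * x * y * (l + x) * (x + y) * (1 + y)) := by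
  have hbij : Function.Bijective fun s => (⟨Quotient.mk (weightedProjSetoid F doublePlaneWeights)
      (doublePlaneRep l s), doublePlaneRep l s, rfl, eval_doublePlaneRep l s⟩ : doublePlane l) := by
    constructor
    · intro s t h
      exact doublePlaneRep_injective l s t (Quotient.exact (congrArg Subtype.val h))
    · rintro ⟨P, x, rfl, hx⟩
      obtain ⟨s, hs⟩ := exists_doublePlaneRep l x hx
      exact ⟨s, Subtype.ext (Quotient.sound hs)⟩
  rw [← Nat.card_congr (Equiv.ofBijective _ hbij), Nat.card_sum, Nat.cast_add,
    card_sq_eq hF (fun q : F × F => (l + 1) * q.1 * q.2 * (l + q.1) * (q.1 + q.2) * (1 + q.2)),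
    Finset.sum_add_distrib, Fintype.sum_prod_type]
  simp
  ring

theorem card_doublePlane_eq (hF : ringChar F ≠ 2) {l : F} (h0 : l ≠ 0) (h1 : l ≠ -1) :
    (Nat.card (doublePlane l) : ℤ) = (Fintype.card F : ℤ) ^ 2 + 1 +
      (Fintype.card F + 1 - (Nat.card (legendreTypeCurve l).toAffine.Point : ℤ)) ^ 2 := by
  have hl : l + 1 ≠ 0 := fun h => h1 (eq_neg_of_add_eq_zero_left h)
  have hsq := sq_sum_quadraticChar hF (c := 1 / (l + 1)) (e := l / (l + 1)) (by simpa using hl)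
    (div_ne_zero h0 hl) (by field_simp; ring)
  -- Scaling both variables by l+1 extracts (l+1)⁶, a square, and exchanges the roles of the two
  -- variables.
  have hscale : ∑ x : F, ∑ y : F,
      quadraticChar F ((l + 1) * x * y * (l + x) * (x + y) * (1 + y)) =
      ∑ k : F, ∑ y : F, quadraticChar F
        (k * (k + 1 / (l + 1)) * (y * (y + l / (l + 1)) * (y + k))) := by
    rw [Finset.sum_comm]
    symm
    refine Fintype.sum_equiv (Equiv.mulLeft₀ _ hl) _ _ fun k =>
      Fintype.sum_equiv (Equiv.mulLeft₀ _ hl) _ _ fun y => ?_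
    change _ = quadraticChar F ((l + 1) * ((l + 1) * y) * ((l + 1) * k) * (l + (l + 1) * y) *
      ((l + 1) * y + (l + 1) * k) * (1 + (l + 1) * k))
    rw [← quadraticChar_sq_mul (pow_ne_zero 3 hl) (k * _ * _)]
    congr 1
    field_simp
    ring
  rw [card_doublePlane hF, card_point_legendreTypeCurve hF h0 h1, hscale]
  linear_combination -hsq

end PointCounts

/-- Excludes p = 2, so that the quadratic character counts square roots. -/
theorem zmod_two_eq_neg_one : ∀ l : ZMod 2, l ≠ 0 → l = -1 := by
  decide

theorem theorem3p10 (p : ℕ) [Fact p.Prime] (l : ZMod p) (hl0 : l ≠ 0) (hl1 : l ≠ -1) :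
    (Nat.card (doublePlane l) : ℤ) = (p : ℤ) ^ 2 + 1 + frobTrace p l ^ 2 := by
  have hF : ringChar (ZMod p) ≠ 2 := by
    rw [ZMod.ringChar_zmod_n]
    rintro rfl
    exact hl1 (zmod_two_eq_neg_one l hl0)
  have := card_doublePlane_eq hF hl0 hl1
  rwa [ZMod.card] at this
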